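/- **Setting.** An instance of Max Cover consists of a universe $\mathcal U$ of $n$ elements, a family $\mathcal S=(S_1,\dots,S_m)$ of $m$ labelled subsets of $\mathcal U$, and an integer $0\le k\le m$. A solution is a set $I\subseteq[m]$ with $|I|=k$; its value is $\mathrm{cov}_{\mathcal S}(I)=\left|\bigcup_{i\in I}S_i\right|$, and $\mathrm{OPT}_k(\mathcal S)=\max_{|I|=k}\mathrm{cov}_{\mathcal S}(I)$. Two families $\mathcal S,\mathcal S'$ over $\mathcal U$ with the same labels are *edge-neighbours* if they differ in exactly one set, and the two versions of that set differ by exactly one element. A randomized mechanism $\mathcal M$ is *$\epsilon$-edge differentially private* if $\Pr[\mathcal M(\mathcal S)\in Y]\le e^{\epsilon}\Pr[\mathcal M(\mathcal S')\in Y]$ for all edge-neighbours $\mathcal S,\mathcal S'$ and all sets $Y$ of outputs. **Theorem.** For every $\eta>0$ there is a constant $C=C(\eta)>0$ such that for all $n,m\in\mathbb N$ and all $\epsilon>0$ there is a randomized mechanism $\mathcal A$ which maps each family $\mathcal S$ of $m$ subsets of an $n$-element universe to an ordering $\sigma$ of the $m$ sets, with the following properties. 1. $\mathcal A$ is $\epsilon$-edge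 differentially private. 2. For every $\mathcal S$, with probability at least $1-1/(n+m)^2$ over the output $\sigma$ of $\mathcal A(\mathcal S)$ (probability $1$ if $n=m=0$), the following holds simultaneously for all $k\in\{0,\dots,m\}$: the first $k$ sets of the ordering satisfy $$\mathrm{cov}_{\mathcal S}\big(\{\sigma(1),\dots,\sigma(k)\}\big)\;\ge\;\Big(1-\frac1e-\eta\Big)\,\mathrm{OPT}_k(\mathcal S)\;-\;C\,\log^3(n+m)\,\frac{k}{\epsilon}.$$ In particular, for each $k$, outputting the first $k$ sets of the ordering is an $\epsilon$-edge differentially private $\big(1-1/e-\eta,\tilde O(k/\epsilon)\big)$-approximation for Max Cover with high probability. If $m\le n^{O(1)}$, the additive loss is $O(\log^3(n)\,k/\epsilon)$. -/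

import Mathlib

/-- A set system with `m` labelled sets `S 0, …, S (m - 1)` over the universe `Fin n`
(equivalently, a bipartite graph between set labels and elements). Labels are public;
the incidences are the private data. -/
abbrev SetSystem (n m : ℕ) : Type := Fin m → Finset (Fin n)

/-- Edge-neighbours: the two set systems differ in exactly one set, and the two versions of that
set differ by exactly one element. -/
def EdgeNeighbor {n m : ℕ} (S S' : SetSystem n m) : Prop :=
  ∃ (i : Fin m) (u : Fin n), symmDiff (S i) (S' i) = {u} ∧ ∀ j, j ≠ i → S j = S' j

/-- Pure `ε`-edge differential privacy of a randomized mechanism with discrete output space `Y`: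
for all edge-neighbours and every event `E`, `Pr[M S ∈ E] ≤ exp ε * Pr[M S' ∈ E]`. -/
def EdgeDP {n m : ℕ} {Y : Type} (ε : ℝ) (M : SetSystem n m → PMF Y) : Prop :=
  ∀ S S' : SetSystem n m, EdgeNeighbor S S' → ∀ E : Set Y,
    (M S).toOuterMeasure E ≤ ENNReal.ofReal (Real.exp ε) * (M S').toOuterMeasure E

/-- The number of elements covered by the sets with labels in `T`. -/
def coverage {n m : ℕ} (S : SetSystem n m) (T : Finset (Fin m)) : ℕ := (T.biUnion S).card

/-- The optimal value of Max Cover: the largest coverage of a choice of exactly `k` sets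
(used for `k ≤ m` only). -/
def optCoverage {n m : ℕ} (S : SetSystem n m) (k : ℕ) : ℕ :=
  (Finset.powersetCard k (Finset.univ : Finset (Fin m))).sup (coverage S)

/-- `T` is a choice of `k` sets which is an `(α, β)`-approximate solution of Max Cover:
multiplicative factor `α`, additive loss `β`. -/
def IsApproxMaxCover {n m : ℕ} (S : SetSystem n m) (k : ℕ) (α β : ℝ) (T : Finset (Fin m)) : Prop :=
  T.card = k ∧ α * (optCoverage S k : ℝ) - β ≤ (coverage S T : ℝ)

/-- An ordering of the `m` sets: `σ j` is the label of the set at position `j`. -/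
abbrev SetOrdering (m : ℕ) : Type := Equiv.Perm (Fin m)

/-- The labels of the first `k` sets of an ordering. -/
def firstSets {m : ℕ} (σ : SetOrdering m) (k : ℕ) : Finset (Fin m) :=
  (Finset.univ.filter fun j : Fin m => (j : ℕ) < k).image σ

/-! Greedy with one private selection per position composes up to `m` mechanisms. Here the positions
are instead cut into `B = O(log m)` chunks with geometrically growing boundaries, and each chunk is
filled by a single exponential mechanism over all sequences of `s` labels, scored by the coverage
reached at its end. Coverage has sensitivity one, so basic composition gives privacy `2 * lam * B =
ε` (`edgeDP_chunkGreedy`).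

There are `m ^ s` candidates, so a chunk loses only `O(s * log (n + m) / lam)` against its best
filling, with high probability (`chunkGreedy_compl_goodChunk_le`). The best filling is at least as
good as `s` exact greedy steps, which shrink the gap to the optimum for `k` by `(1 - 1 / k) ^ s`,
whatever `k` is (`optCoverage_sub_coverage_le`). One good event thus serves all `k`. Some boundary
lies in `[k / (1 + δ), k]`, and stopping there costs only `δ` in the factor `1 - 1 / e`
(`isApproxMaxCover_of_goodChunk`). -/

/-! ### Exponential mechanism and discrete probability. -/

/-- The exponential mechanism on a finite type with log-weights `w`. -/
noncomputable def expMech {Ω : Type} [Fintype Ω] [Nonempty Ω] (w : Ω → ℝ) : PMF Ω :=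
  PMF.ofFintype (fun ω => ENNReal.ofReal (Real.exp (w ω) / ∑ x, Real.exp (w x))) (by
    have hZ : 0 < ∑ x, Real.exp (w x) :=
      Finset.sum_pos (fun _ _ => Real.exp_pos _) Finset.univ_nonempty
    rw [← ENNReal.ofReal_sum_of_nonneg (fun i _ => by positivity), ← Finset.sum_div,
      div_self hZ.ne', ENNReal.ofReal_one])

theorem expMech_apply {Ω : Type} [Fintype Ω] [Nonempty Ω] (w : Ω → ℝ) (ω : Ω) :
    expMech w ω = ENNReal.ofReal (Real.exp (w ω) / ∑ x, Real.exp (w x)) := rfl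

/-- One factor `exp a` comes from the weight of `ω`, the other from the normalizing sum. -/
theorem expMech_le_mul {Ω : Type} [Fintype Ω] [Nonempty Ω] (w w' : Ω → ℝ) (a : ℝ)
    (h : ∀ ω, |w ω - w' ω| ≤ a) (ω : Ω) :
    expMech w ω ≤ ENNReal.ofReal (Real.exp (2 * a)) * expMech w' ω := by
  rw [expMech_apply, expMech_apply, ← ENNReal.ofReal_mul (Real.exp_pos _).le]
  apply ENNReal.ofReal_le_ofReal
  have hZ : 0 < ∑ x, Real.exp (w x) :=
    Finset.sum_pos (fun _ _ => Real.exp_pos _) Finset.univ_nonempty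
  have hZ' : 0 < ∑ x, Real.exp (w' x) :=
    Finset.sum_pos (fun _ _ => Real.exp_pos _) Finset.univ_nonempty
  have h1 : Real.exp (w ω) ≤ Real.exp a * Real.exp (w' ω) := by
    rw [← Real.exp_add, Real.exp_le_exp]
    linarith [(abs_le.1 (h ω)).2]
  have h2 : ∑ x, Real.exp (w' x) ≤ Real.exp a * ∑ x, Real.exp (w x) := by
    rw [Finset.mul_sum]
    refine Finset.sum_le_sum fun x _ => ?_
    rw [← Real.exp_add, Real.exp_le_exp]
    linarith [(abs_le.1 (h x)).1]
  rw [← mul_div_assoc, div_le_div_iff₀ hZ hZ']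
  calc Real.exp (w ω) * ∑ x, Real.exp (w' x)
      ≤ (Real.exp a * Real.exp (w' ω)) * (Real.exp a * ∑ x, Real.exp (w x)) := by gcongr
    _ = Real.exp (2 * a) * Real.exp (w' ω) * ∑ x, Real.exp (w x) := by
        rw [two_mul, Real.exp_add]; ring

/-- The normalizing sum contains the maximal weight, so each bad outcome has probability at most
`exp (-t)`; then a union bound. -/
theorem expMech_toOuterMeasure_compl_le {Ω : Type} [Fintype Ω] [Nonempty Ω] (w : Ω → ℝ) (t : ℝ) :
    (expMech w).toOuterMeasure {ω | ∀ ω', w ω' - t ≤ w ω}ᶜ ≤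
      ENNReal.ofReal (Fintype.card Ω * Real.exp (-t)) := by
  obtain ⟨ω₀, hω₀⟩ := Finite.exists_max w
  rw [PMF.toOuterMeasure_apply_fintype]
  calc _ ≤ ∑ _x : Ω, ENNReal.ofReal (Real.exp (-t)) := by
        refine Finset.sum_le_sum fun x _ => ?_
        refine Set.indicator_le' (fun y hy => ?_) (fun y _ => zero_le (a := ENNReal.ofReal (Real.exp (-t)))) x
        have hy' : w y < w ω₀ - t := by
          by_contra hc
          exact hy fun ω' => by linarith [hω₀ ω']
        rw [expMech_apply]
        apply ENNReal.ofReal_le_ofReal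
        rw [div_le_iff₀ (Finset.sum_pos (fun _ _ => Real.exp_pos _) Finset.univ_nonempty)]
        calc Real.exp (w y) ≤ Real.exp (-t) * Real.exp (w ω₀) := by
              rw [← Real.exp_add, Real.exp_le_exp]; linarith
          _ ≤ _ := by
              gcongr
              exact Finset.single_le_sum (f := fun x => Real.exp (w x))
                (fun _ _ => (Real.exp_pos _).le) (Finset.mem_univ ω₀)
    _ = _ := by
        rw [Finset.sum_const, Finset.card_univ, nsmul_eq_mul,
          ENNReal.ofReal_mul (Nat.cast_nonneg _), ENNReal.ofReal_natCast]

theorem PMF.bind_le_mul {α β : Type} {p q : PMF α} {f g : α → PMF β} {c d : ENNReal}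
    (hp : ∀ a, p a ≤ c * q a) (hf : ∀ a b, f a b ≤ d * g a b) (b : β) :
    p.bind f b ≤ c * d * q.bind g b := by
  rw [PMF.bind_apply, PMF.bind_apply, ← ENNReal.tsum_mul_left]
  refine ENNReal.tsum_le_tsum fun a => ?_
  calc p a * f a b ≤ (c * q a) * (d * g a b) := mul_le_mul' (hp a) (hf a b)
    _ = _ := by ring

theorem PMF.map_le_mul {α β : Type} {p q : PMF α} {d : ENNReal} (φ : α → β)
    (hp : ∀ a, p a ≤ d * q a) (b : β) : p.map φ b ≤ d * q.map φ b := by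
  classical
  rw [PMF.map_apply, PMF.map_apply, ← ENNReal.tsum_mul_left]
  refine ENNReal.tsum_le_tsum fun a => ?_
  split_ifs
  · exact hp a
  · simp

theorem PMF.toOuterMeasure_le_mul {α : Type} {p q : PMF α} {c : ENNReal}
    (hp : ∀ a, p a ≤ c * q a) (E : Set α) :
    p.toOuterMeasure E ≤ c * q.toOuterMeasure E := by
  rw [PMF.toOuterMeasure_apply, PMF.toOuterMeasure_apply, ← ENNReal.tsum_mul_left]
  refine ENNReal.tsum_le_tsum fun a => ?_
  by_cases h : a ∈ E
  · simpa [h] using hp a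
  · simp [h]

theorem PMF.toOuterMeasure_bind_compl_le {α β : Type} (p : PMF α) (f : α → PMF β) (A : Set α)
    (E : Set β) (x y : ENNReal) (hA : p.toOuterMeasure Aᶜ ≤ x)
    (hE : ∀ a ∈ A, (f a).toOuterMeasure Eᶜ ≤ y) :
    (p.bind f).toOuterMeasure Eᶜ ≤ x + y := by
  rw [PMF.toOuterMeasure_bind_apply]
  calc ∑' a, p a * (f a).toOuterMeasure Eᶜ ≤ ∑' a, (Aᶜ.indicator p a + p a * y) := by
        refine ENNReal.tsum_le_tsum fun a => ?_
        by_cases h : a ∈ A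
        · have := hE a h
          simp only [Set.mem_compl_iff, h, not_true_eq_false, not_false_eq_true,
            Set.indicator_of_notMem, zero_add]
          gcongr
        · rw [Set.indicator_of_mem (by exact h)]
          refine le_add_right ?_
          calc p a * (f a).toOuterMeasure Eᶜ ≤ p a * 1 := by
                gcongr
                rw [PMF.toOuterMeasure_apply]
                exact (ENNReal.tsum_le_tsum fun b => Set.indicator_le_self _ _ _).trans_eq
                  (f a).tsum_coe
            _ = p a := mul_one _
    _ = p.toOuterMeasure Aᶜ + y := by
        rw [ENNReal.tsum_add, ENNReal.tsum_mul_right, PMF.tsum_coe, one_mul,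
          PMF.toOuterMeasure_apply]
    _ ≤ x + y := by gcongr

theorem PMF.ofReal_one_sub_le_toOuterMeasure {α : Type} (p : PMF α) (E : Set α) (x : ℝ)
    (hx : 0 ≤ x) (h : p.toOuterMeasure Eᶜ ≤ ENNReal.ofReal x) :
    ENNReal.ofReal (1 - x) ≤ p.toOuterMeasure E := by
  have h1 : (1 : ENNReal) ≤ p.toOuterMeasure E + p.toOuterMeasure Eᶜ := by
    rw [← p.tsum_coe, PMF.toOuterMeasure_apply, PMF.toOuterMeasure_apply, ← ENNReal.tsum_add]
    refine ENNReal.tsum_le_tsum fun a => ?_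
    by_cases ha : a ∈ E <;> simp [ha]
  rw [ENNReal.ofReal_sub _ hx, ENNReal.ofReal_one]
  exact tsub_le_iff_right.2 (h1.trans (by gcongr))

/-! ### Sensitivity of coverage and the greedy argument. -/

section Coverage

variable {n m : ℕ}

theorem coverage_mono (S : SetSystem n m) {T U : Finset (Fin m)} (h : T ⊆ U) :
    coverage S T ≤ coverage S U :=
  Finset.card_le_card (Finset.biUnion_subset_biUnion_of_subset_left _ h)

theorem EdgeNeighbor.symm {S S' : SetSystem n m} (h : EdgeNeighbor S S') : EdgeNeighbor S' S := by
  obtain ⟨i, u, hi, hj⟩ := h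
  exact ⟨i, u, by rw [symmDiff_comm, hi], fun j hne => (hj j hne).symm⟩

theorem EdgeNeighbor.coverage_le {S S' : SetSystem n m} (h : EdgeNeighbor S S')
    (T : Finset (Fin m)) : coverage S T ≤ coverage S' T + 1 := by
  obtain ⟨i, u, hi, hj⟩ := h
  unfold coverage
  refine (Finset.card_le_card (t := insert u (T.biUnion S')) ?_).trans
    (Finset.card_insert_le _ _)
  intro v hv
  obtain ⟨j, hjT, hvj⟩ := Finset.mem_biUnion.1 hv
  by_cases hv' : v ∈ S' j
  · exact Finset.mem_insert_of_mem (Finset.mem_biUnion.2 ⟨j, hjT, hv'⟩)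
  · have hji : j = i := by
      by_contra hne
      exact hv' (hj j hne ▸ hvj)
    subst hji
    have : v ∈ symmDiff (S j) (S' j) := Finset.mem_symmDiff.2 (Or.inl ⟨hvj, hv'⟩)
    rw [hi, Finset.mem_singleton] at this
    exact this ▸ Finset.mem_insert_self _ _

theorem EdgeNeighbor.abs_coverage_sub_le {S S' : SetSystem n m} (h : EdgeNeighbor S S')
    (T : Finset (Fin m)) : |(coverage S T : ℝ) - coverage S' T| ≤ 1 := by
  have h1 : (coverage S T : ℝ) ≤ coverage S' T + 1 := mod_cast h.coverage_le T
  have h2 : (coverage S' T : ℝ) ≤ coverage S T + 1 := mod_cast h.symm.coverage_le T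
  rw [abs_le]
  constructor <;> linarith

theorem coverage_le_add_sum (S : SetSystem n m) (U O : Finset (Fin m)) :
    (coverage S (U ∪ O) : ℝ) ≤
      coverage S U + ∑ x ∈ O, ((coverage S (insert x U) : ℝ) - coverage S U) := by
  have hnat : coverage S (U ∪ O) ≤
      coverage S U + ∑ x ∈ O, (S x \ U.biUnion S).card := by
    unfold coverage
    calc ((U ∪ O).biUnion S).card
        ≤ (U.biUnion S ∪ O.biUnion fun x => S x \ U.biUnion S).card := by
          refine Finset.card_le_card fun v hv => ?_
          simp only [Finset.mem_biUnion, Finset.mem_union, Finset.mem_sdiff] at hv ⊢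
          grind
      _ ≤ _ := (Finset.card_union_le _ _).trans (by gcongr; exact Finset.card_biUnion_le)
  have hx : ∀ x, ((S x \ U.biUnion S).card : ℝ) = (coverage S (insert x U) : ℝ) - coverage S U := by
    intro x
    unfold coverage
    rw [Finset.biUnion_insert, Finset.card_union, ← Finset.card_sdiff_add_card_inter (S x)
      (U.biUnion S)]
    push_cast [Nat.cast_sub (show (S x ∩ U.biUnion S).card ≤ (S x \ U.biUnion S).card +
      (S x ∩ U.biUnion S).card + (U.biUnion S).card by omega)]
    ring
  calc (coverage S (U ∪ O) : ℝ)
      ≤ coverage S U + ∑ x ∈ O, ((S x \ U.biUnion S).card : ℝ) := mod_cast hnat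
    _ = _ := by simp only [hx]

theorem exists_coverage_eq_optCoverage (S : SetSystem n m) {k : ℕ} (hk : k ≤ m) :
    ∃ O : Finset (Fin m), O.card = k ∧ coverage S O = optCoverage S k := by
  have hne : (Finset.powersetCard k (Finset.univ : Finset (Fin m))).Nonempty :=
    Finset.powersetCard_nonempty.2 (by simpa using hk)
  obtain ⟨O, hO, h⟩ := Finset.exists_mem_eq_sup _ hne (coverage S)
  exact ⟨O, (Finset.mem_powersetCard.1 hO).2, h.symm⟩

/-- One greedy step shrinks the gap to the optimum by the factor `1 - 1 / k`. -/
theorem exists_greedy_step (S : SetSystem n m) {k : ℕ} (hk0 : 0 < k) (hk : k ≤ m)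
    (U : Finset (Fin m)) :
    ∃ x, (optCoverage S k : ℝ) - coverage S (insert x U) ≤
      (1 - 1 / k) * ((optCoverage S k : ℝ) - coverage S U) := by
  obtain ⟨O, hO, hopt⟩ := exists_coverage_eq_optCoverage S hk
  have hOne : O.Nonempty := Finset.card_pos.1 (hO ▸ hk0)
  have hk' : (0 : ℝ) < k := mod_cast hk0
  have h1 := coverage_le_add_sum S U O
  have h2 : (optCoverage S k : ℝ) ≤ coverage S (U ∪ O) := by
    rw [← hopt]; exact mod_cast coverage_mono S Finset.subset_union_right
  have h3 : ∑ _x ∈ O, ((optCoverage S k : ℝ) - coverage S U) / k ≤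
      ∑ x ∈ O, ((coverage S (insert x U) : ℝ) - coverage S U) := by
    rw [Finset.sum_const, hO, nsmul_eq_mul, mul_div_cancel₀ _ hk'.ne']
    linarith
  -- Averaging over an optimal `O`: some label gains at least a `1 / k` share of the gap.
  obtain ⟨x, -, hx⟩ := Finset.exists_le_of_sum_le hOne h3
  refine ⟨x, ?_⟩
  have : (1 - 1 / (k : ℝ)) * ((optCoverage S k : ℝ) - coverage S U) =
    (optCoverage S k : ℝ) - coverage S U - ((optCoverage S k : ℝ) - coverage S U) / k := by ring
  linarith

theorem one_sub_one_div_natCast_nonneg (k : ℕ) : (0 : ℝ) ≤ 1 - 1 / k := by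
  rw [one_div]
  linarith [Nat.cast_inv_le_one (α := ℝ) k]

theorem exists_greedy_list (S : SetSystem n m) {k : ℕ} (hk0 : 0 < k) (hk : k ≤ m)
    (U : Finset (Fin m)) (s : ℕ) :
    ∃ l : List (Fin m), l.length = s ∧ (optCoverage S k : ℝ) - coverage S (U ∪ l.toFinset) ≤
      (1 - 1 / k) ^ s * ((optCoverage S k : ℝ) - coverage S U) := by
  induction s with
  | zero => exact ⟨[], rfl, by simp⟩
  | succ s ih =>
    obtain ⟨l, hl, h⟩ := ih
    obtain ⟨x, hx⟩ := exists_greedy_step S hk0 hk (U ∪ l.toFinset)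
    refine ⟨x :: l, by simp [hl], ?_⟩
    rw [List.toFinset_cons, Finset.union_insert]
    refine hx.trans ?_
    rw [pow_succ', mul_assoc]
    exact mul_le_mul_of_nonneg_left h (one_sub_one_div_natCast_nonneg k)

end Coverage

/-! ### Writing labels into an ordering. -/

section Ordering

variable {m : ℕ}

theorem mem_firstSets {σ : SetOrdering m} {k : ℕ} {x : Fin m} :
    x ∈ firstSets σ k ↔ ((σ.symm x : Fin m) : ℕ) < k := by
  simp only [firstSets, Finset.mem_image, Finset.mem_filter, Finset.mem_univ, true_and]
  constructor
  · rintro ⟨j, hj, rfl⟩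
    simpa using hj
  · intro h
    exact ⟨σ.symm x, h, by simp⟩

theorem firstSets_mono (σ : SetOrdering m) {j k : ℕ} (h : j ≤ k) :
    firstSets σ j ⊆ firstSets σ k := by
  intro x hx
  rw [mem_firstSets] at hx ⊢
  omega

theorem card_firstSets (σ : SetOrdering m) {k : ℕ} (hk : k ≤ m) : (firstSets σ k).card = k := by
  unfold firstSets
  rw [Finset.card_image_of_injective _ σ.injective, Fin.card_filter_val_lt, min_eq_right hk]

/-- Put the label `x` at position `p`, unless it already occurs earlier. -/
def placeAt (p : ℕ) (σ : SetOrdering m) (x : Fin m) : SetOrdering m :=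
  if h : p < m then
    if ((σ.symm x : Fin m) : ℕ) < p then σ else (Equiv.swap ⟨p, h⟩ (σ.symm x)).trans σ
  else σ

theorem firstSets_placeAt (p : ℕ) (σ : SetOrdering m) (x : Fin m) {j : ℕ} (hj : j ≤ p) :
    firstSets (placeAt p σ x) j = firstSets σ j := by
  unfold placeAt
  split_ifs with h1 h2
  · rfl
  · ext y
    simp only [mem_firstSets, Equiv.symm_trans_apply, Equiv.symm_swap, Equiv.swap_apply_def]
    split_ifs with h3 h4
    · rw [h3]
      simp only []
      omega
    · rw [h4]
      simp only []
      omega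
    · rfl
  · rfl

theorem mem_firstSets_placeAt {p : ℕ} (hp : p < m) (σ : SetOrdering m) (x : Fin m) :
    x ∈ firstSets (placeAt p σ x) (p + 1) := by
  unfold placeAt
  rw [dif_pos hp]
  split_ifs with h2
  · rw [mem_firstSets]; omega
  · rw [mem_firstSets, Equiv.symm_trans_apply, Equiv.symm_swap, Equiv.swap_apply_right]
    simp

/-- Put the labels of a list at the positions `p, p + 1, …`. -/
def placeList : ℕ → SetOrdering m → List (Fin m) → SetOrdering m
  | _, σ, [] => σ
  | p, σ, x :: l => placeList (p + 1) (placeAt p σ x) l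

theorem firstSets_placeList (l : List (Fin m)) (p : ℕ) (σ : SetOrdering m) {j : ℕ} (hj : j ≤ p) :
    firstSets (placeList p σ l) j = firstSets σ j := by
  induction l generalizing p σ with
  | nil => rfl
  | cons x l ih => rw [placeList, ih _ _ (by omega), firstSets_placeAt _ _ _ hj]

/-- A repeated label leaves its position with the label already there, so only an inclusion holds;
coverage is monotone, so this suffices. -/
theorem subset_firstSets_placeList (l : List (Fin m)) (p : ℕ) (σ : SetOrdering m)
    (h : p + l.length ≤ m) :
    firstSets σ p ∪ l.toFinset ⊆ firstSets (placeList p σ l) (p + l.length) := by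
  induction l generalizing p σ with
  | nil => simp [placeList]
  | cons x l ih =>
    rw [List.length_cons] at h ⊢
    have ih' := ih (p + 1) (placeAt p σ x) (by omega)
    rw [show p + 1 + l.length = p + (l.length + 1) by ring] at ih'
    rw [placeList, List.toFinset_cons]
    refine subset_trans ?_ ih'
    have h1 : firstSets σ p ⊆ firstSets (placeAt p σ x) (p + 1) := by
      rw [← firstSets_placeAt p σ x le_rfl]
      exact firstSets_mono _ (by omega)
    have h2 := mem_firstSets_placeAt (show p < m by omega) σ x
    intro y hy
    simp only [Finset.mem_union, Finset.mem_insert] at hy ⊢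
    rcases hy with hy | rfl | hy
    · exact Or.inl (h1 hy)
    · exact Or.inl h2
    · exact Or.inr hy

end Ordering

/-! ### The chunked mechanism: privacy and utility. -/

section Mechanism

variable {n m : ℕ}

/-- The log-weight of a sequence of labels filling the positions `p, …, p + s - 1`. -/
noncomputable def chunkScore (lam : ℝ) (S : SetSystem n m) (σ : SetOrdering m) (p s : ℕ)
    (ω : Fin s → Fin m) : ℝ :=
  lam * coverage S (firstSets (placeList p σ (List.ofFn ω)) (p + s))

/-- Privately fill the positions `p, …, p + s - 1` of an ordering. -/
noncomputable def chunkMech [NeZero m] (lam : ℝ) (S : SetSystem n m) (p s : ℕ)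
    (σ : SetOrdering m) : PMF (SetOrdering m) :=
  (expMech (chunkScore lam S σ p s)).map fun ω => placeList p σ (List.ofFn ω)

/-- Private greedy in chunks: chunk `b` fills the positions `p b, …, p (b + 1) - 1`. -/
noncomputable def chunkGreedy [NeZero m] (lam : ℝ) (p : ℕ → ℕ) (S : SetSystem n m) :
    ℕ → PMF (SetOrdering m)
  | 0 => PMF.pure 1
  | b + 1 => (chunkGreedy lam p S b).bind (chunkMech lam S (p b) (p (b + 1) - p b))

theorem chunkMech_le_mul [NeZero m] {lam : ℝ} (hlam : 0 ≤ lam) {S S' : SetSystem n m}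
    (h : EdgeNeighbor S S') (p s : ℕ) (σ τ : SetOrdering m) :
    chunkMech lam S p s σ τ ≤ ENNReal.ofReal (Real.exp (2 * lam)) * chunkMech lam S' p s σ τ := by
  refine PMF.map_le_mul _ (expMech_le_mul _ _ _ fun ω => ?_) τ
  unfold chunkScore
  rw [← mul_sub, abs_mul, abs_of_nonneg hlam]
  exact mul_le_of_le_one_right hlam (h.abs_coverage_sub_le _)

/-- Basic composition: the cost is per chunk, independent of chunk length. -/
theorem chunkGreedy_le_mul [NeZero m] {lam : ℝ} (hlam : 0 ≤ lam) (p : ℕ → ℕ)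
    {S S' : SetSystem n m} (h : EdgeNeighbor S S') (B : ℕ) (σ : SetOrdering m) :
    chunkGreedy lam p S B σ ≤
      ENNReal.ofReal (Real.exp (2 * lam)) ^ B * chunkGreedy lam p S' B σ := by
  induction B generalizing σ with
  | zero => rw [pow_zero, one_mul]; exact le_rfl
  | succ B ih =>
    rw [pow_succ]
    exact PMF.bind_le_mul ih (fun a b => chunkMech_le_mul hlam h _ _ a b) σ

theorem edgeDP_chunkGreedy [NeZero m] {lam ε : ℝ} (hlam : 0 ≤ lam) (p : ℕ → ℕ) (B : ℕ)
    (hε : 2 * lam * B = ε) :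
    EdgeDP (n := n) (m := m) ε fun S => chunkGreedy lam p S B := by
  intro S S' h E
  refine PMF.toOuterMeasure_le_mul (fun σ => (chunkGreedy_le_mul hlam p h B σ).trans_eq ?_) E
  rw [← ENNReal.ofReal_pow (Real.exp_pos _).le, ← Real.exp_nat_mul, ← hε, mul_comm (B : ℝ)]

/-- Chunk `a` of the ordering is within `t` per position of the best way to fill it. -/
def GoodChunk (S : SetSystem n m) (p : ℕ → ℕ) (t : ℝ) (a : ℕ) (σ : SetOrdering m) : Prop :=
  ∀ l : List (Fin m), l.length = p (a + 1) - p a →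
    (coverage S (firstSets σ (p a) ∪ l.toFinset) : ℝ) - (p (a + 1) - p a : ℕ) * t ≤
      coverage S (firstSets σ (p (a + 1)))

theorem chunkMech_compl_goodChunk_le [NeZero m] {lam : ℝ} (hlam : 0 < lam) (S : SetSystem n m)
    {p : ℕ → ℕ} (hp : Monotone p) (hpm : ∀ b, p b ≤ m) {t x : ℝ} (hx1 : x ≤ 1)
    (hx : m * Real.exp (-(lam * t)) ≤ x) (b : ℕ) (σ : SetOrdering m)
    (hσ : ∀ a < b, GoodChunk S p t a σ) :
    (chunkMech lam S (p b) (p (b + 1) - p b) σ).toOuterMeasure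
      {τ | ∀ a < b + 1, GoodChunk S p t a τ}ᶜ ≤ ENNReal.ofReal x := by
  set s := p (b + 1) - p b with hs
  have hps : p b + s = p (b + 1) := Nat.add_sub_cancel' (hp (Nat.le_succ b))
  have hx0 : 0 ≤ x := le_trans (by positivity) hx
  unfold chunkMech
  rw [PMF.toOuterMeasure_map_apply]
  have key : ∀ ω : Fin s → Fin m,
      (∀ ω', chunkScore lam S σ (p b) s ω' - s * (lam * t) ≤ chunkScore lam S σ (p b) s ω) →
      ∀ a < b + 1, GoodChunk S p t a (placeList (p b) σ (List.ofFn ω)) := by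
    intro ω hω a ha
    have hab : p a ≤ p b := hp (by omega)
    intro l hl
    rw [firstSets_placeList _ _ _ hab]
    rcases Nat.lt_succ_iff_lt_or_eq.1 ha with hab' | rfl
    · rw [firstSets_placeList _ _ _ (hp (by omega))]
      exact hσ a hab' l hl
    · obtain ⟨ω', hω'⟩ : ∃ ω' : Fin s → Fin m, List.ofFn ω' = l := by
        rw [← hs] at hl
        clear_value s
        subst hl
        exact ⟨l.get, List.ofFn_get l⟩
      have h1 := hω ω'
      unfold chunkScore at h1
      rw [hps, hω'] at h1
      have h2 : (coverage S (firstSets (placeList (p a) σ l) (p (a + 1))) : ℝ) - s * t ≤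
          coverage S (firstSets (placeList (p a) σ (List.ofFn ω)) (p (a + 1))) := by
        refine le_of_mul_le_mul_left ?_ hlam
        linarith
      have h3 := subset_firstSets_placeList l (p a) σ (by rw [hl, ← hs, hps]; exact hpm _)
      rw [hl, ← hs, hps] at h3
      have h4 : (coverage S (firstSets σ (p a) ∪ l.toFinset) : ℝ) ≤
        coverage S (firstSets (placeList (p a) σ l) (p (a + 1))) := mod_cast coverage_mono S h3
      linarith
  have hmono : (expMech (chunkScore lam S σ (p b) s)).toOuterMeasure
      ((fun ω => placeList (p b) σ (List.ofFn ω)) ⁻¹' {τ | ∀ a < b + 1, GoodChunk S p t a τ}ᶜ) ≤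
      (expMech (chunkScore lam S σ (p b) s)).toOuterMeasure
        {ω | ∀ ω', chunkScore lam S σ (p b) s ω' - s * (lam * t) ≤
          chunkScore lam S σ (p b) s ω}ᶜ :=
    MeasureTheory.measure_mono fun ω hω hc => hω (key ω hc)
  refine hmono.trans ?_
  -- The union bound gives `x ^ s`, at most `x` only for `s ≥ 1`. Empty chunks, which occur once the
  -- schedule hits its cap, have a single candidate and never fail.
  rcases Nat.eq_zero_or_pos s with h0 | h0
  · have hempty : {ω | ∀ ω', chunkScore lam S σ (p b) s ω' - s * (lam * t) ≤
        chunkScore lam S σ (p b) s ω}ᶜ = (∅ : Set (Fin s → Fin m)) := by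
      rw [Set.compl_empty_iff, Set.eq_univ_iff_forall]
      intro ω ω'
      have : IsEmpty (Fin s) := by rw [h0]; infer_instance
      rw [Subsingleton.elim ω' ω]
      simp [h0]
    rw [hempty]
    simp
  · refine (expMech_toOuterMeasure_compl_le _ _).trans (ENNReal.ofReal_le_ofReal ?_)
    rw [Fintype.card_fun, Fintype.card_fin, Fintype.card_fin, ← mul_neg, Real.exp_nat_mul,
      Nat.cast_pow, ← mul_pow]
    calc (m * Real.exp (-(lam * t))) ^ s ≤ x ^ s := by gcongr
      _ ≤ x := pow_le_of_le_one hx0 hx1 h0.ne'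

theorem chunkGreedy_compl_goodChunk_le [NeZero m] {lam : ℝ} (hlam : 0 < lam) (S : SetSystem n m)
    {p : ℕ → ℕ} (hp : Monotone p) (hpm : ∀ b, p b ≤ m) {t x : ℝ} (hx1 : x ≤ 1)
    (hx : m * Real.exp (-(lam * t)) ≤ x) (B : ℕ) :
    (chunkGreedy lam p S B).toOuterMeasure {τ | ∀ a < B, GoodChunk S p t a τ}ᶜ ≤
      ENNReal.ofReal (B * x) := by
  have hx0 : 0 ≤ x := le_trans (by positivity) hx
  induction B with
  | zero => simp
  | succ B ih =>
    refine (PMF.toOuterMeasure_bind_compl_le _ _ _ _ _ _ ih fun σ hσ =>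
      chunkMech_compl_goodChunk_le hlam S hp hpm hx1 hx B σ hσ).trans_eq ?_
    rw [← ENNReal.ofReal_add (by positivity) hx0]
    push_cast
    ring_nf

/-- Each chunk competes with the greedy list for `k`. Later contractions do not enlarge earlier
errors, so these sum to at most `t` per position. -/
theorem optCoverage_sub_coverage_le (S : SetSystem n m) {p : ℕ → ℕ} (hp : Monotone p)
    (hp0 : p 0 = 0) {t : ℝ} (ht : 0 ≤ t) {σ : SetOrdering m} {k : ℕ} (hk0 : 0 < k) (hk : k ≤ m)
    (b : ℕ) (hσ : ∀ a < b, GoodChunk S p t a σ) :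
    (optCoverage S k : ℝ) - coverage S (firstSets σ (p b)) ≤
      (1 - 1 / k) ^ p b * optCoverage S k + p b * t := by
  induction b with
  | zero => simp [hp0]
  | succ b ih =>
    have ih' := ih fun a ha => hσ a (by omega)
    obtain ⟨l, hl, h⟩ := exists_greedy_list S hk0 hk (firstSets σ (p b)) (p (b + 1) - p b)
    have h2 := hσ b (by omega) l hl
    set s := p (b + 1) - p b with hs
    have hps : p (b + 1) = p b + s := (Nat.add_sub_cancel' (hp (Nat.le_succ b))).symm
    have hr := one_sub_one_div_natCast_nonneg k
    have hr1 : (1 - 1 / (k : ℝ)) ^ s ≤ 1 :=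
      pow_le_one₀ hr (by linarith [show (0 : ℝ) ≤ 1 / k by positivity])
    have h3 := mul_le_mul_of_nonneg_left ih' (pow_nonneg hr s)
    have h4 : (1 - 1 / (k : ℝ)) ^ s * (p b * t) ≤ p b * t :=
      mul_le_of_le_one_left (by positivity) hr1
    have h5 : (1 - 1 / (k : ℝ)) ^ p (b + 1) * optCoverage S k =
        (1 - 1 / (k : ℝ)) ^ s * ((1 - 1 / (k : ℝ)) ^ p b * optCoverage S k) := by
      rw [hps, pow_add]; ring
    have h6 : (p (b + 1) : ℝ) * t = p b * t + s * t := by rw [hps]; push_cast; ring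
    rw [h5, h6]
    linarith

end Mechanism

/-! ### Geometric schedule and the approximation factor. -/

/-- Chunk boundaries growing geometrically with ratio `y`, capped at `m`. -/
noncomputable def geomSchedule (y : ℝ) (m : ℕ) : ℕ → ℕ
  | 0 => 0
  | b + 1 => min m ⌈y ^ b⌉₊

theorem geomSchedule_monotone {y : ℝ} (hy : 1 ≤ y) (m : ℕ) : Monotone (geomSchedule y m) := by
  refine monotone_nat_of_le_succ fun b => ?_
  cases b with
  | zero => exact Nat.zero_le _
  | succ b => exact min_le_min_left _ (Nat.ceil_mono (pow_le_pow_right₀ hy (Nat.le_succ b)))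

theorem geomSchedule_le (y : ℝ) (m b : ℕ) : geomSchedule y m b ≤ m := by
  cases b with
  | zero => exact Nat.zero_le _
  | succ b => exact min_le_left _ _

theorem exists_geomSchedule_near {y : ℝ} (hy : 1 < y) {k m : ℕ} (hk0 : 0 < k) (hk : k ≤ m) :
    ∃ b : ℕ, b ≤ ⌊Real.log m / Real.log y⌋₊ + 1 ∧ geomSchedule y m b ≤ k ∧
      (k : ℝ) / y ≤ geomSchedule y m b := by
  obtain ⟨b, h1, h2⟩ := exists_nat_pow_near (show (1 : ℝ) ≤ k from mod_cast hk0) hy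
  have hc : ⌈y ^ b⌉₊ ≤ k := Nat.ceil_le.2 h1
  have hmin : geomSchedule y m (b + 1) = ⌈y ^ b⌉₊ := min_eq_right (hc.trans hk)
  refine ⟨b + 1, ?_, by rw [hmin]; exact hc, ?_⟩
  · gcongr
    refine Nat.le_floor ?_
    rw [le_div_iff₀ (Real.log_pos hy), ← Real.log_pow]
    exact Real.log_le_log (by positivity) (h1.trans (mod_cast hk))
  · rw [hmin]
    refine le_trans ?_ (Nat.le_ceil _)
    rw [div_le_iff₀ (by linarith), ← pow_succ]
    exact h2.le

theorem isApproxMaxCover_of_goodChunk {n m : ℕ} (S : SetSystem n m) {δ t : ℝ} (hδ0 : 0 < δ)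
    (hδ1 : δ ≤ 1) (ht : 0 ≤ t) {B : ℕ} (hB : ⌊Real.log m / Real.log (1 + δ)⌋₊ + 1 ≤ B)
    {σ : SetOrdering m} (hσ : ∀ a < B, GoodChunk S (geomSchedule (1 + δ) m) t a σ)
    {k : ℕ} (hk : k ≤ m) :
    IsApproxMaxCover S k (1 - 1 / Real.exp 1 - δ) (k * t) (firstSets σ k) := by
  refine ⟨card_firstSets σ hk, ?_⟩
  rcases Nat.eq_zero_or_pos k with rfl | hk0
  · simp [optCoverage, coverage]
  obtain ⟨b, hbB, hbk, hb⟩ := exists_geomSchedule_near (y := 1 + δ) (by linarith) hk0 hk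
  have h1 := optCoverage_sub_coverage_le S (geomSchedule_monotone (by linarith) m) rfl ht hk0 hk b
    fun a ha => hσ a (by omega)
  set q := geomSchedule (1 + δ) m b
  have hk' : (0 : ℝ) < k := mod_cast hk0
  have h2 : (coverage S (firstSets σ q) : ℝ) ≤ coverage S (firstSets σ k) :=
    mod_cast coverage_mono S (firstSets_mono σ hbk)
  have h3 : (q : ℝ) * t ≤ k * t := by gcongr
  have h4 : (1 - 1 / (k : ℝ)) ^ q ≤ 1 / Real.exp 1 + δ := by
    -- Uses `1 - δ ≤ 1 / (1 + δ) ≤ q / k`.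
    have hq : 1 - δ ≤ q * (1 / k) := by
      rw [mul_one_div, le_div_iff₀ hk']
      refine le_trans ?_ hb
      rw [le_div_iff₀ (by linarith)]
      nlinarith [mul_nonneg hk'.le (sq_nonneg δ)]
    calc (1 - 1 / (k : ℝ)) ^ q ≤ Real.exp (-(1 / k)) ^ q :=
          pow_le_pow_left₀ (one_sub_one_div_natCast_nonneg k) (Real.one_sub_le_exp_neg _) q
      _ = Real.exp (-(q * (1 / k))) := by rw [← Real.exp_nat_mul, mul_neg]
      _ ≤ Real.exp (-1 + δ) := Real.exp_le_exp.2 (by linarith)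
      _ = 1 / Real.exp 1 * Real.exp δ := by rw [Real.exp_add, Real.exp_neg, one_div]
      _ ≤ 1 / Real.exp 1 * (1 + 2 * δ) := by
          have := Real.abs_exp_sub_one_le (x := δ) (by rw [abs_of_pos hδ0]; exact hδ1)
          rw [abs_of_pos hδ0] at this
          gcongr
          linarith [(abs_le.1 this).2]
      _ ≤ 1 / Real.exp 1 + δ := by
          have h2e : 1 / Real.exp 1 ≤ 1 / 2 :=
            one_div_le_one_div_of_le two_pos (by linarith [Real.add_one_le_exp (1 : ℝ)])
          nlinarith
  have h5 := mul_le_mul_of_nonneg_right h4 (Nat.cast_nonneg (α := ℝ) (optCoverage S k))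
  linarith

theorem IsApproxMaxCover.mono {n m : ℕ} {S : SetSystem n m} {k : ℕ} {α α' β β' : ℝ}
    {T : Finset (Fin m)} (h : IsApproxMaxCover S k α β T) (hα : α' ≤ α) (hβ : β ≤ β') :
    IsApproxMaxCover S k α' β' T := by
  refine ⟨h.1, le_trans ?_ h.2⟩
  gcongr

theorem edgeDP_const {n m : ℕ} {Y : Type} {ε : ℝ} (hε : 0 ≤ ε) (q : PMF Y) :
    EdgeDP (n := n) (m := m) ε fun _ => q := by
  intro S S' _ E
  refine le_mul_of_one_le_left zero_le ?_
  rw [ENNReal.one_le_ofReal]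
  exact Real.one_le_exp hε

/-! ### Choice of parameters. -/

theorem mainTheorem1 (η : ℝ) (hη : 0 < η) :
    ∃ C : ℝ, 0 < C ∧
      ∀ (n m : ℕ) (ε : ℝ), 0 < ε →
        ∃ A : SetSystem n m → PMF (SetOrdering m),
          EdgeDP ε A ∧
          ∀ S : SetSystem n m,
            ENNReal.ofReal (1 - 1 / ((n : ℝ) + (m : ℝ)) ^ 2) ≤
              (A S).toOuterMeasure
                {σ | ∀ k : ℕ, k ≤ m →
                  IsApproxMaxCover S k (1 - 1 / Real.exp 1 - η)
                    (C * Real.log ((n : ℝ) + (m : ℝ)) ^ 3 * (k : ℝ) / ε) (firstSets σ k)} := by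
  set δ := min 1 η with hδ
  have hδ0 : 0 < δ := lt_min one_pos hη
  have hδ1 : δ ≤ 1 := min_le_left _ _
  have hδη : δ ≤ η := min_le_right _ _
  have hlogy : 0 < Real.log (1 + δ) := Real.log_pos (by linarith)
  -- The `+ 2` absorbs the `+ 1` in `B`, since `L ≥ 1 / 2`.
  set D := 1 / Real.log (1 + δ) + 2 with hD
  have hD0 : 0 < D := by positivity
  refine ⟨4 * D * (3 + D), by positivity, fun n m ε hε => ?_⟩
  rcases Nat.eq_zero_or_pos m with rfl | hm
  · refine ⟨fun _ => PMF.pure 1, edgeDP_const hε.le _, fun S => ?_⟩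
    refine PMF.ofReal_one_sub_le_toOuterMeasure _ _ _ (by positivity) ?_
    rw [show {σ : SetOrdering 0 | _}ᶜ = (∅ : Set (SetOrdering 0)) from ?_]
    · simp
    · rw [Set.compl_empty_iff, Set.eq_univ_iff_forall]
      intro σ k hk
      obtain rfl : k = 0 := by omega
      exact ⟨card_firstSets σ le_rfl, by simp [optCoverage, coverage]⟩
  -- When `n + m = 1` the required probability is `0`.
  rcases Nat.lt_or_ge (n + m) 2 with hN | hN
  · refine ⟨fun _ => PMF.pure 1, edgeDP_const hε.le _, fun S => ?_⟩
    have h1 : (n : ℝ) + m = 1 := by exact_mod_cast (show n + m = 1 by omega)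
    rw [h1]
    simp
  have : NeZero m := ⟨hm.ne'⟩
  set N : ℝ := (n : ℝ) + m with hNdef
  have hN2 : (2 : ℝ) ≤ N := by rw [hNdef]; exact_mod_cast hN
  have hm1 : (1 : ℝ) ≤ m := mod_cast hm
  have hmN : (m : ℝ) ≤ N := by rw [hNdef]; linarith [Nat.cast_nonneg (α := ℝ) n]
  set L := Real.log N with hL
  have hL2 : 1 / 2 ≤ L := by
    have := Real.log_le_log two_pos hN2
    linarith [Real.log_two_gt_d9]
  have hmL : Real.log m ≤ L := Real.log_le_log (by linarith) hmN
  have hlogm : 0 ≤ Real.log m := Real.log_nonneg hm1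
  set B := ⌊Real.log m / Real.log (1 + δ)⌋₊ + 1 with hB
  have hB1 : (1 : ℝ) ≤ B := by exact_mod_cast Nat.succ_pos _
  have hBD : (B : ℝ) ≤ D * L := by
    have h1 : (B : ℝ) ≤ Real.log m / Real.log (1 + δ) + 1 := by
      rw [hB]
      push_cast
      gcongr
      exact Nat.floor_le (by positivity)
    have h2 : Real.log m / Real.log (1 + δ) ≤ L / Real.log (1 + δ) := by gcongr
    have h3 : D * L = L / Real.log (1 + δ) + 2 * L := by rw [hD]; ring
    linarith
  have hlogB : 0 ≤ Real.log B := Real.log_nonneg hB1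
  set lam := ε / (2 * B) with hlam
  have hlam0 : 0 < lam := by positivity
  -- Chosen so that `m * exp (-(lam * t)) = 1 / (B * N ^ 2)`; the `B` chunks then fail with total
  -- probability at most `1 / N ^ 2`.
  set t := (Real.log m + Real.log B + 2 * L) / lam with ht
  have ht0 : 0 ≤ t := by positivity
  refine ⟨fun S => chunkGreedy lam (geomSchedule (1 + δ) m) S B,
    edgeDP_chunkGreedy hlam0.le _ B (by rw [hlam]; field_simp), fun S => ?_⟩
  refine PMF.ofReal_one_sub_le_toOuterMeasure _ _ _ (by positivity) ?_
  have hx : (m : ℝ) * Real.exp (-(lam * t)) ≤ 1 / (B * N ^ 2) := by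
    rw [ht, mul_div_cancel₀ _ hlam0.ne', Real.exp_neg, Real.exp_add, Real.exp_add,
      Real.exp_log (by linarith), Real.exp_log (by linarith), two_mul, Real.exp_add,
      Real.exp_log (by linarith)]
    apply le_of_eq
    field_simp
  have hx1 : 1 / (B * N ^ 2) ≤ 1 := by
    rw [div_le_one (by positivity)]
    nlinarith
  have hgood := chunkGreedy_compl_goodChunk_le hlam0 S
    (geomSchedule_monotone (y := 1 + δ) (by linarith) m) (geomSchedule_le _ m) hx1 hx B
  have hBx : (B : ℝ) * (1 / (B * N ^ 2)) = 1 / N ^ 2 := by field_simp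
  rw [hBx] at hgood
  refine le_trans (MeasureTheory.measure_mono (Set.compl_subset_compl.2 fun σ hσ k hk => ?_)) hgood
  refine (isApproxMaxCover_of_goodChunk S hδ0 hδ1 ht0 le_rfl hσ hk).mono (by linarith) ?_
  have hsum : Real.log m + Real.log B + 2 * L ≤ (3 + D) * L := by
    have := Real.log_le_self (x := (B : ℝ)) (by linarith)
    linarith
  have htC : t ≤ 4 * D * (3 + D) * L ^ 3 / ε := by
    have h1 : t = (Real.log m + Real.log B + 2 * L) * (2 * B) / ε := by
      rw [ht, hlam]; field_simp
    rw [h1]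
    refine div_le_div_of_nonneg_right ?_ hε.le
    -- The bound is quadratic in `L`; `1 ≤ 2 * L` lifts it to the cubic form.
    calc (Real.log m + Real.log B + 2 * L) * (2 * B) ≤ ((3 + D) * L) * (2 * (D * L)) := by gcongr
      _ = 2 * D * (3 + D) * L ^ 2 * 1 := by ring
      _ ≤ 2 * D * (3 + D) * L ^ 2 * (2 * L) := by gcongr; linarith
      _ = 4 * D * (3 + D) * L ^ 3 := by ring
  calc (k : ℝ) * t ≤ k * (4 * D * (3 + D) * L ^ 3 / ε) := by gcongr
    _ = 4 * D * (3 + D) * L ^ 3 * k / ε := by ring
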